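/- Let $q$ be a prime power of the form $q=1+16a^2$ with $a\in\mathbb Z$, let $\gamma$ be a primitive element of the finite field $\mathbb F_q$, and put $l=\frac{q-1}{4}$. Let $H=\langle \tau\mid\tau^l=1\rangle$ be the cyclic group of order $l$, acting on the additive group of $\mathbb F_q$ by letting $\tau$ act as $x\mapsto\gamma^4x$, and let $G=\mathbb F_q\rtimes H$ be the corresponding semidirect product, so that $\tau x=(\gamma^4x)\tau$ in $G$ for $x\in\mathbb F_q$. Let $D_2^4=\gamma^2\langle\gamma^4\rangle\subset\mathbb F_q^*$ be the cyclotomic class of order four with index two, let $S=-1+D_2^4=\{-1+x: x\in D_2^4\}\subset\mathbb F_q$, and let $E=SH=\{sh: s\in S,\ h\in H\}\subset G$. Let $\mathrm{Cay}(G,E)$ be the digraph with vertex set $G$ in which $g\to h$ if and only if $g^{-1}h\in E$. Then $E$ generates $G$, and $\mathrm{Cay}(G,E)$ is a directed strongly regular graph with parameters $$(v,k,t,\lambda,\mu)=\left(q\,\tfrac{q-1}{4},\ \left(\tfrac{q-1}{4}\right)^2,\ \left(\tfrac{q-1}{8}\right)^2,\ \left(\tfrac{q-1}{8}\right)^2-\tfrac{q-1}{16},\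 \left(\tfrac{q-1}{8}\right)^2\right).$$ Here a directed graph without loops on $v$ vertices, with adjacency matrix $A$, is called directed strongly regular with parameters $(v,k,t,\lambda,\mu)$ if $A^2=tI+\lambda A+\mu(J-I-A)$ and $AJ=JA=kJ$, where $I$ is the identity matrix and $J$ the all-ones matrix. -/

import Mathlib

noncomputable section

/-- The Cayley digraph `Cay(G, S)`: there is an edge `g → h` if and only if `g⁻¹ h ∈ S`. -/
def cayleyDigraph {G : Type*} [Group G] (S : Set G) : Digraph G where
  Adj g h := g⁻¹ * h ∈ S

open Classical in
/-- The adjacency matrix of a digraph, with integer entries. -/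
def Digraph.adjacencyMatrix {V : Type*} (Γ : Digraph V) : Matrix V V ℤ :=
  Matrix.of fun x y => if Γ.Adj x y then 1 else 0

/-- The all-ones matrix `J`. -/
def allOnesMatrix (V : Type*) : Matrix V V ℤ :=
  Matrix.of fun _ _ => 1

open Classical in
/-- A loopless digraph `Γ` on a finite vertex set is directed strongly regular with parameters
`(v, k, t, lam, mu)` if it has `v` vertices and its adjacency matrix `A` satisfies
`A² = t I + lam A + mu (J - I - A)` and `A J = J A = k J`. -/
def IsDirectedStronglyRegular {V : Type*} (Γ : Digraph V) (v k t lam mu : ℕ) : Prop :=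
  ∃ _ : Fintype V,
    Fintype.card V = v ∧
    (∀ x : V, ¬ Γ.Adj x x) ∧
    Γ.adjacencyMatrix * Γ.adjacencyMatrix =
      (t : ℤ) • (1 : Matrix V V ℤ) + (lam : ℤ) • Γ.adjacencyMatrix +
        (mu : ℤ) • (allOnesMatrix V - 1 - Γ.adjacencyMatrix) ∧
    Γ.adjacencyMatrix * allOnesMatrix V = (k : ℤ) • allOnesMatrix V ∧
    allOnesMatrix V * Γ.adjacencyMatrix = (k : ℤ) • allOnesMatrix V

/-- The cyclotomic class `D_i^e = γ^i ⟨γ^e⟩` of order `e` (for a primitive element `γ`). -/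
def cyclotomicClass {F : Type*} [Field F] (γ : Fˣ) (e i : ℕ) : Set F :=
  {x | ∃ y ∈ Subgroup.zpowers (γ ^ e), x = ((γ ^ i * y : Fˣ) : F)}

/-- The homomorphism from the cyclic group `⟨τ | τ^l = 1⟩` (modelled as `ℤ/l` written
multiplicatively, with `τ = Multiplicative.ofAdd 1`) to a group `M` that sends `τ` to `u`,
where `u ^ l = 1`. -/
def cyclicHom {M : Type*} [Group M] (l : ℕ) (u : M) (hu : u ^ l = 1) :
    Multiplicative (ZMod l) →* M :=
  AddMonoidHom.toMultiplicativeLeft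
    (ZMod.lift l ⟨zmultiplesHom (Additive M) (Additive.ofMul u), by
      simp only [zmultiplesHom_apply, natCast_zsmul, ← ofMul_pow, hu, ofMul_one]⟩)

theorem cyclicHom_generator {M : Type*} [Group M] (l : ℕ) (u : M) (hu : u ^ l = 1) :
    cyclicHom l u hu (Multiplicative.ofAdd 1) = u := by
  have h := ZMod.lift_castAddHom l
    ⟨zmultiplesHom (Additive M) (Additive.ofMul u), by
      simp only [zmultiplesHom_apply, natCast_zsmul, ← ofMul_pow, hu, ofMul_one]⟩ (1 : ℤ)
  simp only [Int.coe_castAddHom, Int.cast_one, zmultiplesHom_apply, one_zsmul] at h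
  change Additive.toMul (ZMod.lift l _ 1) = u
  rw [h, toMul_ofMul]

/-- The units of `F` acting on the additive group of `F` (written multiplicatively) by
multiplication. -/
def scalingAut (F : Type*) [Field F] : Fˣ →* MulAut (Multiplicative F) :=
  (MulAutMultiplicative F).symm.toMonoidHom.comp (DistribMulAction.toAddAut Fˣ F)

theorem scalingAut_apply {F : Type*} [Field F] (u : Fˣ) (x : F) :
    scalingAut F u (Multiplicative.ofAdd x) = Multiplicative.ofAdd ((u : F) * x) := rfl

/-- The semidirect product `F ⋊ H` of the additive group of `F` with the cyclic group
`H = ⟨τ | τ^l = 1⟩`, where `τ` acts on `F` as multiplication by `u`. -/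
abbrev FieldSemidirect {F : Type*} [Field F] (l : ℕ) (u : Fˣ) (hu : u ^ l = 1) : Type _ :=
  Multiplicative F ⋊[(scalingAut F).comp (cyclicHom l u hu)] Multiplicative (ZMod l)

/-- In `F ⋊ H` one has `τ x = (u x) τ`. -/
theorem FieldSemidirect.generator_mul {F : Type*} [Field F] (l : ℕ) (u : Fˣ) (hu : u ^ l = 1)
    (x : F) :
    (SemidirectProduct.inr (Multiplicative.ofAdd 1) *
      SemidirectProduct.inl (Multiplicative.ofAdd x) : FieldSemidirect l u hu) =
    SemidirectProduct.inl (Multiplicative.ofAdd ((u : F) * x)) *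
      SemidirectProduct.inr (Multiplicative.ofAdd 1) := by
  rw [← scalingAut_apply]
  ext <;> simp [cyclicHom_generator]

/-- The subset `S H = {s h | s ∈ S, h ∈ H}` of `F ⋊ H`, for `S ⊆ F`. -/
def FieldSemidirect.setMulH {F : Type*} [Field F] (l : ℕ) (u : Fˣ) (hu : u ^ l = 1)
    (S : Set F) : Set (FieldSemidirect l u hu) :=
  {g | ∃ s ∈ S, ∃ h : Multiplicative (ZMod l),
    g = SemidirectProduct.inl (Multiplicative.ofAdd s) * SemidirectProduct.inr h}

/-- If `|F| = q = 1 + 16 a²` and `l = (q - 1) / 4`, then fourth powers of units have order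
dividing `l`, so that the action of `⟨τ | τ^l = 1⟩` through `γ^4` is well defined. -/
theorem pow_four_pow_eq_one {F : Type*} [Field F] [Fintype F] {q : ℕ}
    (hF : Fintype.card F = q) {a : ℤ} (hq : (q : ℤ) = 1 + 16 * a ^ 2) {l : ℕ}
    (hl : l = (q - 1) / 4) (γ : Fˣ) : (γ ^ 4) ^ l = 1 := by
  have h : 4 * l = q - 1 := by
    generalize a ^ 2 = b at hq
    omega
  rw [← pow_mul, h]
  ext
  rw [Units.val_pow_eq_pow_val, Units.val_one, ← hF]
  exact FiniteField.pow_card_sub_one_eq_one _ γ.ne_zero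

end

/-!
Write `q = 4 l + 1`, so that `l = 4 a²`. In the group ring of `F ⋊ H` one has
`E² = S H S H = (S · ∑ h ∈ H, h S) H`, and `∑ h ∈ H, h S` gives each `v ≠ 0` the number of points
of `S = -1 + D₂` in the quartic class of `v` as its coefficient. These four numbers are the
cyclotomic numbers `(i, 2)` of order four. If all of them equal `n`, the sum is `n (F - {0})` and
`E² = n |S| G - n E`, which is the directed strongly regular equation
(`FieldSemidirect.isDirectedStronglyRegular_setMulH`). As `n ≠ 0`, every `H`-orbit on the nonzero
elements meets `S`, and `E` generates the group.

The heart is therefore `four_mul_cyclotomicNumber_neg_one`: if `q = 1 + 16 a²`, then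
`4 (i, 2) = l` for every `i`. The symmetries `x ↦ -1 - x` and `x ↦ x⁻¹` leave only two values, `C`
for even and `E` for odd `i`, with `2 C + 2 E = l`. Put `s = 1 + 4 (C - E)`. Splitting the sum
`∑ z, η(z² - 1)` of the quadratic character `η` according to `η(z)` shows that the Jacobsthal sum
`∑ x, η(x³ - x)` equals `-2 s` (`jacobsthalSum_one_eq_cyclotomicNumber`). Jacobsthal's identity
`jacobsthalSum_one_sq_add_sq`, a second moment computation, then yields `q = s² + (2 t)²`.

This representation is to be compared with `q = 1² + (4 a)²`. For a prime power only primitive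
representations are essentially unique, so it must be excluded that the characteristic `p` divides
`s`. By Euler's criterion the Jacobsthal sum is congruent to `± (2 l).choose l` modulo `p`
(`intCast_jacobsthalSum_one`), and `p` does not divide this binomial coefficient by Kummer's
theorem (`not_dvd_centralBinom_of_prime_pow`). Hence `s² = 1`, and `s ≡ 1` modulo `4` forces
`s = 1`, that is, `C = E`.
-/

/-! ### Jacobsthal sums -/

/-- The Jacobsthal sum `∑ x, η(x) η(x² - d) = ∑ x, η(x³ - d x)` of the quadratic character `η`. -/
def jacobsthalSum {F : Type*} [Field F] [Fintype F] [DecidableEq F] (d : F) : ℤ :=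
  ∑ x : F, quadraticChar F x * quadraticChar F (x ^ 2 - d)

section Jacobsthal

variable {F : Type*} [Field F] [Fintype F] [DecidableEq F]

theorem sum_quadraticChar_sub_mul_sub (hF : ringChar F ≠ 2) {u v : F} (huv : u ≠ v) :
    ∑ d : F, quadraticChar F (u - d) * quadraticChar F (v - d) = -1 := by
  have hne : v - u ≠ 0 := sub_ne_zero.2 huv.symm
  have hJ := jacobiSum_nontrivial_inv (R := ℤ) (quadraticChar_ne_one hF)
  rw [(quadraticChar_isQuadratic (F := F)).inv, jacobiSum] at hJ
  -- the substitution `d = u + (v - u) x` turns the sum into a Jacobi sum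
  rw [← ((Equiv.mulLeft₀ (v - u) hne).trans (Equiv.addLeft u)).sum_comp]
  have hx : ∀ x : F, quadraticChar F (u - ((Equiv.mulLeft₀ (v - u) hne).trans (Equiv.addLeft u)) x)
      * quadraticChar F (v - ((Equiv.mulLeft₀ (v - u) hne).trans (Equiv.addLeft u)) x)
      = quadraticChar F (-1) * (quadraticChar F x * quadraticChar F (1 - x)) := by
    intro x
    have h1 : quadraticChar F ((v - u) ^ 2) = 1 := quadraticChar_sq_one' hne
    rw [← map_mul, ← map_mul, ← map_mul,
      ← one_mul (quadraticChar F (-1 * _)), ← h1, ← map_mul]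
    congr 1
    simp
    ring
  simp_rw [hx]
  rw [← Finset.mul_sum, hJ]
  have := quadraticChar_sq_one (F := F) (a := -1) (by simp)
  linear_combination -this

theorem sum_quadraticChar_sq_sub_one (hF : ringChar F ≠ 2) :
    ∑ z : F, quadraticChar F (z ^ 2 - 1) = -1 := by
  rw [← sum_quadraticChar_sub_mul_sub hF (u := (1 : F)) (v := -1)
    (Ring.neg_one_ne_one_of_char_ne_two hF).symm]
  refine Finset.sum_congr rfl fun x _ => ?_
  rw [← map_mul]
  congr 1
  ring

theorem jacobsthalSum_sq_mul {c : F} (hc : c ≠ 0) (d : F) :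
    jacobsthalSum (c ^ 2 * d) = quadraticChar F c * jacobsthalSum d := by
  unfold jacobsthalSum
  rw [← Equiv.sum_comp (Equiv.mulLeft₀ c hc), Finset.mul_sum]
  refine Finset.sum_congr rfl fun x _ => ?_
  have h1 : quadraticChar F (c ^ 2) = 1 := quadraticChar_sq_one' hc
  simp only [Equiv.mulLeft₀_apply]
  rw [show (c * x) ^ 2 - c ^ 2 * d = c ^ 2 * (x ^ 2 - d) by ring, map_mul, map_mul, h1]
  ring

theorem jacobsthalSum_zero (hF : ringChar F ≠ 2) : jacobsthalSum (0 : F) = 0 := by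
  rw [← quadraticChar_sum_zero hF]
  refine Finset.sum_congr rfl fun x _ => ?_
  rcases eq_or_ne x 0 with rfl | hx
  · simp
  · rw [sub_zero, quadraticChar_sq_one' hx, mul_one]

/-- Off the diagonal `x² = y²` the inner sum over `d` is `-1`, on it `q - 1`. -/
theorem sum_quadraticChar_sq_sub_mul (hF : ringChar F ≠ 2) (x y : F) :
    ∑ d : F, quadraticChar F (x ^ 2 - d) * quadraticChar F (y ^ 2 - d) =
      -1 + (Fintype.card F : ℤ) * (if x ^ 2 = y ^ 2 then 1 else 0) := by
  split_ifs with h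
  · rw [h, ← (Equiv.subLeft (y ^ 2)).sum_comp]
    simp only [Equiv.subLeft_apply, sub_sub_cancel]
    rw [Finset.sum_congr rfl (g := fun d : F => 1 - if d = 0 then 1 else 0)]
    · simp
      ring
    · intro d _
      split_ifs with hd
      · simp [hd]
      · rw [← sq, quadraticChar_sq_one hd, sub_zero]
  · rw [sum_quadraticChar_sub_mul_sub hF h]
    simp

theorem sum_jacobsthalSum_sq (hF : ringChar F ≠ 2) (h1 : quadraticChar F (-1) = 1) :
    ∑ d : F, jacobsthalSum d ^ 2 =
      2 * (Fintype.card F : ℤ) * ((Fintype.card F : ℤ) - 1) := by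
  have e1 : ∑ d : F, jacobsthalSum d ^ 2 = ∑ x : F, ∑ y : F,
      quadraticChar F x * quadraticChar F y *
        ∑ d : F, quadraticChar F (x ^ 2 - d) * quadraticChar F (y ^ 2 - d) := by
    simp_rw [sq (jacobsthalSum _), jacobsthalSum, Finset.sum_mul_sum, Finset.mul_sum]
    rw [Finset.sum_comm]
    refine Finset.sum_congr rfl fun x _ => ?_
    rw [Finset.sum_comm]
    refine Finset.sum_congr rfl fun y _ => Finset.sum_congr rfl fun d _ => ?_
    ring
  have hdiag : ∀ x : F, ∑ y : F, quadraticChar F x * quadraticChar F y *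
      (if x ^ 2 = y ^ 2 then 1 else 0) = 2 - 2 * if x = 0 then 1 else 0 := by
    intro x
    split_ifs with hx
    · simp [hx]
    · have hxx : x ≠ -x := fun h => hx ((Ring.eq_self_iff_eq_zero_of_char_ne_two hF).1 h.symm)
      rw [← Finset.sum_subset (Finset.subset_univ {x, -x}), Finset.sum_pair hxx]
      · have h2 : quadraticChar F (-x) = quadraticChar F x := by
          rw [← neg_one_mul, map_mul, h1, one_mul]
        have h3 := quadraticChar_sq_one hx
        simp only [neg_sq, if_true, h2]
        linear_combination 2 * h3
      · intro y _ hy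
        rw [if_neg, mul_zero]
        intro h
        rcases sq_eq_sq_iff_eq_or_eq_neg.1 h.symm with h | h <;> simp [h] at hy
  rw [e1]
  simp_rw [sum_quadraticChar_sq_sub_mul hF, mul_add, Finset.sum_add_distrib,
    mul_left_comm _ (Fintype.card F : ℤ), ← Finset.mul_sum, hdiag]
  simp_rw [← Finset.sum_mul, ← Finset.mul_sum, quadraticChar_sum_zero hF]
  simp
  ring

/-- Jacobsthal's identity: `jacobsthalSum d ^ 2` depends only on the quadratic class of `d`, so
the second moment over all `d` evaluates the sum of the two nonzero values. -/
theorem jacobsthalSum_one_sq_add_sq (hF : ringChar F ≠ 2) (h1 : quadraticChar F (-1) = 1)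
    {g : F} (hg : quadraticChar F g = -1) :
    jacobsthalSum (1 : F) ^ 2 + jacobsthalSum g ^ 2 = 4 * (Fintype.card F : ℤ) := by
  have hg0 : g ≠ 0 := by rintro rfl; simp at hg
  have key : ∀ d : F, 2 * jacobsthalSum d ^ 2 =
      jacobsthalSum (1 : F) ^ 2 * (1 + quadraticChar F d) +
      jacobsthalSum g ^ 2 * (1 - quadraticChar F d) -
      (jacobsthalSum (1 : F) ^ 2 + jacobsthalSum g ^ 2) * (if d = 0 then 1 else 0) := by
    intro d
    split_ifs with hd
    · rw [hd, jacobsthalSum_zero hF, quadraticChar_zero]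
      ring
    · have hs : ∀ e : F, quadraticChar F (d * e) = 1 → e ≠ 0 →
          jacobsthalSum d ^ 2 = jacobsthalSum e ^ 2 := by
        intro e h he
        obtain ⟨c, hc⟩ := (quadraticChar_one_iff_isSquare (mul_ne_zero hd he)).1 h
        have hc0 : c ≠ 0 := by rintro rfl; simp [hd, he] at hc
        have : d = (c / e) ^ 2 * e := by field_simp; linear_combination hc
        have h3 := quadraticChar_sq_one (div_ne_zero hc0 he)
        rw [this, jacobsthalSum_sq_mul (div_ne_zero hc0 he), mul_pow, h3, one_mul]
      rcases quadraticChar_dichotomy hd with h | h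
      · rw [hs 1 (by simpa using h) one_ne_zero, h]
        ring
      · rw [hs g (by rw [map_mul, h, hg]; norm_num) hg0, h]
        ring
  have hsum : ∑ d : F, 2 * jacobsthalSum d ^ 2 = _ := Finset.sum_congr rfl fun d _ => key d
  simp_rw [Finset.sum_sub_distrib, Finset.sum_add_distrib, ← Finset.mul_sum,
    Finset.sum_sub_distrib, Finset.sum_add_distrib, quadraticChar_sum_zero hF,
    sum_jacobsthalSum_sq hF h1] at hsum
  simp at hsum
  have hq : (1 : ℤ) < Fintype.card F := by exact_mod_cast Fintype.one_lt_card
  have hq' : (Fintype.card F : ℤ) - 1 ≠ 0 := by omega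
  apply mul_left_cancel₀ hq'
  linear_combination -hsum

end Jacobsthal

/-! ### The Jacobsthal sum modulo the characteristic -/

/-- No carry occurs when `l` is added to itself in base `p`: the last `i` digits of
`l = (p ^ n - 1) / 4` are those of `(p ^ i - 1) / 4`. -/
theorem not_dvd_centralBinom_of_prime_pow {p n l : ℕ} (hp : p.Prime) (hp4 : p % 4 = 1)
    (hl : p ^ n = 4 * l + 1) : ¬ p ∣ (l + l).choose l := by
  have hfac := Nat.factorization_choose' (p := p) (n := l) (k := l) hp
    (Nat.lt_succ_self (Nat.log p (l + l)))
  rw [Finset.filter_false_of_mem, Finset.card_empty] at hfac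
  · intro hd
    have := (hp.dvd_iff_one_le_factorization (Nat.choose_pos (by omega)).ne').1 hd
    omega
  · intro i hi
    simp only [Finset.mem_Ico] at hi
    have hmod : ∀ j, p ^ j % 4 = 1 := fun j => by rw [Nat.pow_mod, hp4]; simp
    have hi4 := hmod i
    have hpos : 0 < p ^ i := pow_pos hp.pos i
    push Not
    rcases le_total i n with hin | hin
    · obtain ⟨k, rfl⟩ := Nat.exists_eq_add_of_le hin
      have hk4 := hmod k
      obtain ⟨b, hb⟩ : ∃ b, p ^ i = 4 * b + 1 := ⟨p ^ i / 4, by omega⟩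
      obtain ⟨c, hc⟩ : ∃ c, p ^ k = 4 * c + 1 := ⟨p ^ k / 4, by omega⟩
      rw [pow_add, hb, hc] at hl
      have : l = b + (4 * b + 1) * c := by linarith
      rw [hb, this, Nat.add_mul_mod_self_left, Nat.mod_eq_of_lt (by omega)]
      omega
    · have hle : p ^ n ≤ p ^ i := Nat.pow_le_pow_right hp.pos hin
      have := Nat.mod_le l (p ^ i)
      omega

theorem FiniteField.sum_pow_eq_ite {F : Type*} [Field F] [Fintype F] {k : ℕ} (hk : k ≠ 0) :
    ∑ x : F, x ^ k = if Fintype.card F - 1 ∣ k then -1 else 0 := by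
  classical
  have hmap := Finset.sum_map Finset.univ ⟨fun x : Fˣ => (x : F), Units.val_injective⟩
    (fun x => x ^ k)
  refine Eq.trans (Eq.symm ?_) (hmap.trans (FiniteField.sum_pow_units F k))
  apply Finset.sum_subset (Finset.subset_univ _)
  intro x _ hx
  by_cases h : x = 0
  · simp [h, hk]
  · exact absurd (Finset.mem_map.2 ⟨Units.mk0 x h, Finset.mem_univ _, rfl⟩) hx

theorem ringChar_ne_two_of_card {F : Type*} [Field F] [Fintype F] {l : ℕ}
    (hq : Fintype.card F = 4 * l + 1) : ringChar F ≠ 2 := by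
  intro h
  have := FiniteField.even_card_iff_char_two.1 h
  omega

/-- Euler's criterion turns the Jacobsthal sum into a power sum in `F`, of which only the
middle binomial coefficient survives. -/
theorem intCast_jacobsthalSum_one {F : Type*} [Field F] [Fintype F] [DecidableEq F]
    {l : ℕ} (hl0 : l ≠ 0) (hl : Fintype.card F = 4 * l + 1) :
    ((jacobsthalSum (1 : F) : ℤ) : F) = -((-1) ^ l * ((l + l).choose l : F)) := by
  have hF := ringChar_ne_two_of_card hl
  have h2 : Fintype.card F / 2 = l + l := by omega
  have hx : ∀ x : F, ((quadraticChar F x * quadraticChar F (x ^ 2 - 1) : ℤ) : F) =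
      ∑ j ∈ Finset.range (l + l + 1),
        (-1) ^ (l + l - j) * ((l + l).choose j : F) * x ^ (l + l + 2 * j) := by
    intro x
    rw [Int.cast_mul, quadraticChar_eq_pow_of_char_ne_two' hF,
      quadraticChar_eq_pow_of_char_ne_two' hF, h2, sub_eq_add_neg, add_pow, Finset.mul_sum]
    refine Finset.sum_congr rfl fun j _ => ?_
    rw [← pow_mul, pow_add x (l + l)]
    ring
  rw [jacobsthalSum, Int.cast_sum, Finset.sum_congr rfl fun x _ => hx x, Finset.sum_comm]
  simp_rw [← Finset.mul_sum]
  rw [Finset.sum_eq_single l]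
  · rw [FiniteField.sum_pow_eq_ite (by omega), if_pos ⟨1, by omega⟩, Nat.add_sub_cancel]
    ring
  · intro j hj hjl
    rw [FiniteField.sum_pow_eq_ite (by omega), if_neg, mul_zero]
    rw [Finset.mem_range] at hj
    -- the exponent lies in `[2 l, 6 l]`, where `4 l` is the only multiple of `q - 1 = 4 l`
    rintro ⟨c, hc⟩
    rw [hl, Nat.add_sub_cancel] at hc
    have hc0 : c ≠ 0 := by rintro rfl; omega
    have hc1 : c ≠ 1 := by rintro rfl; omega
    have : 4 * l * 2 ≤ 4 * l * c := Nat.mul_le_mul_left _ (by omega)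
    omega
  · intro h
    simp at h

/-! ### Representations as a sum of two squares -/

/-- Primitive representations of a prime power `q = 1 + (4 a)²` as `s² + (2 t)²` are trivial:
`q` divides `(4 a s)² - (2 t)²`, hence one of the factors `4 a s ± 2 t`, which is then zero. -/
theorem sq_eq_one_of_sq_add_sq_eq {p n : ℕ} (hp : p.Prime) (hn : n ≠ 0) {a s t : ℤ}
    (hq : (p : ℤ) ^ n = 1 + 16 * a ^ 2) (hst : s ^ 2 + 4 * t ^ 2 = (p : ℤ) ^ n)
    (hs : ¬ (p : ℤ) ∣ s) : s ^ 2 = 1 := by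
  have hpZ : Prime (p : ℤ) := Nat.prime_iff_prime_int.1 hp
  have main : ∀ t : ℤ, s ^ 2 + 4 * t ^ 2 = (p : ℤ) ^ n →
      (p : ℤ) ^ n ∣ 4 * a * s - 2 * t → s ^ 2 = 1 := by
    rintro t hst ⟨c, hc⟩
    have hqpos : 0 < (p : ℤ) ^ n := pow_pos (by exact_mod_cast hp.pos) n
    have hid : (4 * a * s - 2 * t) ^ 2 + (s + 8 * a * t) ^ 2 = ((p : ℤ) ^ n) ^ 2 := by
      rw [sq ((p : ℤ) ^ n)]
      nth_rw 1 [hq]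
      rw [← hst]
      ring
    have hc1 : c ^ 2 ≤ 1 := by
      have h : ((p : ℤ) ^ n) ^ 2 * c ^ 2 ≤ ((p : ℤ) ^ n) ^ 2 * 1 := by
        rw [← mul_pow, ← hc]
        nlinarith [sq_nonneg (s + 8 * a * t)]
      exact le_of_mul_le_mul_left h (by positivity)
    have hc3 : c ≤ 1 := by nlinarith
    have hc4 : -1 ≤ c := by nlinarith
    have hc0 : c = 0 := by
      -- `c = ±1` is impossible because `q` is odd and `4 a s - 2 t` is even
      rw [hq, mul_assoc] at hc
      generalize a ^ 2 = b at hc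
      generalize a * s = d at hc
      obtain rfl | rfl | rfl : c = -1 ∨ c = 0 ∨ c = 1 := by omega
      all_goals omega
    have h2t : 2 * t = 4 * a * s := by rw [hc0, mul_zero] at hc; omega
    have : (1 + 16 * a ^ 2) * s ^ 2 = (1 + 16 * a ^ 2) * 1 := by
      linear_combination -(2 * t + 4 * a * s) * h2t + hst + hq
    exact mul_left_cancel₀ (by positivity) this
  have hprod : (p : ℤ) ^ n ∣ (4 * a * s - 2 * t) * (4 * a * s + 2 * t) := by
    refine ⟨s ^ 2 - 1, ?_⟩
    linear_combination (-s ^ 2) * hq + (-1 : ℤ) * hst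
  by_cases h1 : (p : ℤ) ∣ 4 * a * s - 2 * t
  · by_cases h2 : (p : ℤ) ∣ 4 * a * s + 2 * t
    · exfalso
      have h3 : (p : ℤ) ∣ 8 * a * s := by
        have := dvd_add h1 h2
        rwa [show 4 * a * s - 2 * t + (4 * a * s + 2 * t) = 8 * a * s by ring] at this
      have h4 := (hpZ.dvd_or_dvd h3).resolve_right hs
      have h5 : (p : ℤ) ∣ 1 + 16 * a ^ 2 := hq ▸ dvd_pow_self _ hn
      have h6 := dvd_sub h5 (h4.mul_left (2 * a))
      rw [show 1 + 16 * a ^ 2 - 2 * a * (8 * a) = 1 by ring] at h6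
      exact hpZ.not_dvd_one h6
    · refine main t hst ?_
      exact IsCoprime.dvd_of_dvd_mul_right
        (IsCoprime.pow_left ((Prime.coprime_iff_not_dvd hpZ).2 h2)) hprod
  · refine main (-t) (by rw [neg_sq]; exact hst) ?_
    have := IsCoprime.dvd_of_dvd_mul_left
        (IsCoprime.pow_left (m := n) ((Prime.coprime_iff_not_dvd hpZ).2 h1)) hprod
    rwa [show 4 * a * s - 2 * -t = 4 * a * s + 2 * t by ring]

/-! ### Cyclotomic numbers of order four -/

theorem pow_mem_fourth_roots {F : Type*} [Field F] [Fintype F] {l : ℕ}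
    (hq : Fintype.card F = 4 * l + 1) {i : F} (hi : i ^ 2 = -1)
    {x : F} (hx : x ≠ 0) : x ^ l = 1 ∨ x ^ l = -1 ∨ x ^ l = i ∨ x ^ l = -i := by
  have h4 : (x ^ l) ^ 4 = 1 := by
    rw [← pow_mul, mul_comm, ← Nat.add_sub_cancel (4 * l) 1, ← hq]
    exact FiniteField.pow_card_sub_one_eq_one x hx
  have : (x ^ l - 1) * ((x ^ l + 1) * ((x ^ l - i) * (x ^ l + i))) = 0 := by
    linear_combination h4 - ((x ^ l) ^ 2 - 1) * hi
  rcases mul_eq_zero.1 this with h | h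
  · exact Or.inl (sub_eq_zero.1 h)
  rcases mul_eq_zero.1 h with h | h
  · exact Or.inr (Or.inl (eq_neg_of_add_eq_zero_left h))
  rcases mul_eq_zero.1 h with h | h
  · exact Or.inr (Or.inr (Or.inl (sub_eq_zero.1 h)))
  · exact Or.inr (Or.inr (Or.inr (eq_neg_of_add_eq_zero_left h)))

/-- The number of `x` with `x ^ l = c` and `(x + 1) ^ l = d`. When `q = 4 l + 1` and `c`, `d` are
fourth roots of unity this is a cyclotomic number of order four: the classes of order four are the
fibres of `x ↦ x ^ l` over the fourth roots of unity. -/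
def cyclotomicNumber {F : Type*} [Field F] [Fintype F] [DecidableEq F] (l : ℕ) (c d : F) : ℕ :=
  (Finset.univ.filter fun x : F => x ^ l = c ∧ (x + 1) ^ l = d).card

section CyclotomicNumber

variable {F : Type*} [Field F] [Fintype F] [DecidableEq F]

theorem cyclotomicNumber_comm {l : ℕ} (hev : Even l) (c d : F) :
    cyclotomicNumber l c d = cyclotomicNumber l d c := by
  refine Finset.card_equiv (Equiv.subLeft (-1)) fun x => ?_
  have h1 : (-1 - x) ^ l = (x + 1) ^ l := by rw [← hev.neg_pow]; congr 1; ring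
  have h2 : (-1 - x + 1) ^ l = x ^ l := by rw [← hev.neg_pow]; congr 1; ring
  simp only [Finset.mem_filter, Finset.mem_univ, true_and, Equiv.subLeft_apply, h1, h2]
  exact and_comm

theorem cyclotomicNumber_inv {l : ℕ} (hl : l ≠ 0) {c : F} (hc : c ≠ 0) (d : F) :
    cyclotomicNumber l c d = cyclotomicNumber l c⁻¹ (d * c⁻¹) := by
  refine Finset.card_equiv (Equiv.inv F) fun x => ?_
  simp only [Finset.mem_filter, Finset.mem_univ, true_and, Equiv.inv_apply]
  rcases eq_or_ne x 0 with rfl | hx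
  · simp [zero_pow hl, hc.symm, Ne.symm (inv_ne_zero hc)]
  · rw [inv_pow, inv_inj]
    refine and_congr_right fun h => ?_
    have : x⁻¹ + 1 = (x + 1) * x⁻¹ := by field_simp; ring
    rw [this, mul_pow, inv_pow, h]
    exact (mul_left_inj' (inv_ne_zero hc)).symm

theorem quadraticChar_eq_of_pow {l : ℕ} (hq : Fintype.card F = 4 * l + 1) {x : F} (hx : x ≠ 0) :
    quadraticChar F x = if (x ^ l) ^ 2 = 1 then 1 else -1 := by
  have h2 : Fintype.card F / 2 = l * 2 := by omega
  rw [quadraticChar_eq_pow_of_char_ne_two (ringChar_ne_two_of_card hq) hx, h2, pow_mul]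

/-- The indicator of `F \ {0}` and the quadratic character, expanded over the quartic classes. -/
theorem indicator_and_quadraticChar_eq {l : ℕ} (hl : l ≠ 0) (hq : Fintype.card F = 4 * l + 1)
    {i : F} (hi : i ^ 2 = -1) (x : F) :
    ((if x = 0 then 0 else 1 : ℤ) = (if x ^ l = 1 then 1 else 0) + (if x ^ l = -1 then 1 else 0) +
      ((if x ^ l = i then 1 else 0) + (if x ^ l = -i then 1 else 0))) ∧
    (quadraticChar F x = (if x ^ l = 1 then 1 else 0) + (if x ^ l = -1 then 1 else 0) -
      ((if x ^ l = i then 1 else 0) + (if x ^ l = -i then 1 else 0))) := by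
  have h11 : (-1 : F) ≠ 1 := Ring.neg_one_ne_one_of_char_ne_two (ringChar_ne_two_of_card hq)
  have hi0 : i ≠ 0 := by rintro rfl; simp at hi
  have hii : i ≠ -i := fun h => hi0
    ((Ring.eq_self_iff_eq_zero_of_char_ne_two (ringChar_ne_two_of_card hq)).1 h.symm)
  have hi1 : i ≠ 1 := by rintro rfl; rw [one_pow] at hi; exact h11 hi.symm
  have hi2 : i ≠ -1 := by rintro rfl; rw [neg_one_sq] at hi; exact h11 hi.symm
  have hi3 : -i ≠ 1 := fun h => hi2 (by rw [← h, neg_neg])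
  have hi4 : -i ≠ -1 := fun h => hi1 (neg_injective h)
  rcases eq_or_ne x 0 with rfl | hx
  · simp [zero_pow hl, hi0, hi0.symm]
  · rw [if_neg hx, quadraticChar_eq_of_pow hq hx]
    rcases pow_mem_fourth_roots hq hi hx with h | h | h | h <;>
      simp [h, hi, h11, h11.symm, hii, hii.symm, hi1, hi1.symm, hi2, hi2.symm, hi3, hi3.symm,
        hi4, hi4.symm]

theorem cast_cyclotomicNumber (l : ℕ) (c d : F) : (cyclotomicNumber l c d : ℤ) =
    ∑ x : F, (if (x + 1) ^ l = d then 1 else 0) * (if x ^ l = c then 1 else 0) := by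
  rw [cyclotomicNumber, Finset.card_filter, Nat.cast_sum]
  refine Finset.sum_congr rfl fun x _ => ?_
  by_cases h1 : x ^ l = c <;> by_cases h2 : (x + 1) ^ l = d <;> simp [h1, h2]

/-- Each of the four fibres of `x ↦ x ^ l` has at most `l` elements, and together they have `4 l`. -/
theorem card_filter_pow_eq_neg_one {l : ℕ} (hl : l ≠ 0) (hq : Fintype.card F = 4 * l + 1)
    {i : F} (hi : i ^ 2 = -1) : (Finset.univ.filter fun x : F => x ^ l = -1).card = l := by
  have hle : ∀ c : F, (Finset.univ.filter fun x : F => x ^ l = c).card ≤ l := by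
    intro c
    refine le_trans (Finset.card_le_card (t := (Polynomial.nthRoots l c).toFinset) ?_)
      ((Multiset.toFinset_card_le _).trans (Polynomial.card_nthRoots l c))
    intro x hx
    simpa [Polynomial.mem_nthRoots (Nat.pos_of_ne_zero hl)] using hx
  have hsum := Finset.sum_congr (rfl : (Finset.univ : Finset F) = Finset.univ)
    fun x _ => (indicator_and_quadraticChar_eq hl hq hi x).1
  have h0 : ∑ x : F, (if x = 0 then 0 else 1 : ℤ) = 4 * l := by
    rw [Finset.sum_congr rfl (g := fun x : F => 1 - if x = 0 then 1 else 0)]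
    · simp [hq]
    · intro x _
      split_ifs <;> simp
  rw [h0] at hsum
  simp_rw [Finset.sum_add_distrib, Finset.sum_boole] at hsum
  have h1 := hle 1
  have h2 := hle (-1)
  have h3 := hle i
  have h4 := hle (-i)
  omega

theorem sum_cyclotomicNumber_neg_one {l : ℕ} (hl : l ≠ 0) (hq : Fintype.card F = 4 * l + 1)
    {i : F} (hi : i ^ 2 = -1) :
    (cyclotomicNumber l (1 : F) (-1) : ℤ) + cyclotomicNumber l (-1 : F) (-1) +
      (cyclotomicNumber l i (-1) + cyclotomicNumber l (-i) (-1)) = l := by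
  simp_rw [cast_cyclotomicNumber, ← Finset.sum_add_distrib, ← mul_add,
    ← (indicator_and_quadraticChar_eq hl hq hi _).1]
  have h := Equiv.sum_comp (Equiv.addRight (1 : F))
    (fun y => if y ^ l = (-1 : F) then (1 : ℤ) else 0)
  have h' := h.trans (Finset.sum_boole _ _)
  rw [card_filter_pow_eq_neg_one hl hq hi] at h'
  refine Eq.trans (Finset.sum_congr rfl fun x _ => ?_) h'
  have h11 : (1 : F) ≠ -1 :=
    (Ring.neg_one_ne_one_of_char_ne_two (ringChar_ne_two_of_card hq)).symm
  rcases eq_or_ne x 0 with rfl | hx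
  · simp [h11]
  · rw [if_neg hx, mul_one]
    rfl

/-- The nonsquares `z` contribute to `jacobsthalSum 1` through their squares, which run twice
through the class `y ^ l = -1`. -/
theorem jacobsthalSum_one_eq_cyclotomicNumber {l : ℕ} (hl : l ≠ 0)
    (hq : Fintype.card F = 4 * l + 1) (h1 : quadraticChar F (-1) = 1) {i : F} (hi : i ^ 2 = -1) :
    jacobsthalSum (1 : F) = -2 - 4 * ((cyclotomicNumber l (1 : F) (-1) : ℤ) +
      cyclotomicNumber l (-1 : F) (-1) -
      (cyclotomicNumber l i (-1) + cyclotomicNumber l (-i) (-1))) := by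
  have hF := ringChar_ne_two_of_card hq
  have h11 : (-1 : F) ≠ 1 := Ring.neg_one_ne_one_of_char_ne_two hF
  set f : F → ℤ := fun y => (if y ^ l = -1 then 1 else 0) * quadraticChar F (y - 1) with hf
  have e1 : ∑ x : F, f x = (cyclotomicNumber l (1 : F) (-1) : ℤ) +
      cyclotomicNumber l (-1 : F) (-1) -
      (cyclotomicNumber l i (-1) + cyclotomicNumber l (-i) (-1)) := by
    simp_rw [cast_cyclotomicNumber, ← Finset.sum_add_distrib, ← mul_add,
      ← Finset.sum_sub_distrib, ← mul_sub, ← (indicator_and_quadraticChar_eq hl hq hi _).2]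
    rw [← Equiv.sum_comp (Equiv.addRight (1 : F)) f]
    simp [hf]
  have e2 : ∑ z : F, f (z ^ 2) = 2 * ∑ y : F, f y := by
    rw [← Finset.sum_fiberwise Finset.univ (fun z : F => z ^ 2) (fun z => f (z ^ 2)),
      Finset.mul_sum]
    refine Finset.sum_congr rfl fun y _ => ?_
    rw [Finset.sum_congr rfl (g := fun _ => f y)
      fun z hz => by rw [(Finset.mem_filter.1 hz).2], Finset.sum_const, nsmul_eq_mul]
    have hc := quadraticChar_card_sqrts hF y
    rw [Set.toFinset_ofPred] at hc
    rw [hc]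
    by_cases hy : y ^ l = -1
    · have hy0 : y ≠ 0 := by rintro rfl; simp [zero_pow hl] at hy
      rw [quadraticChar_eq_of_pow hq hy0, hy]
      norm_num
    · simp [hf, hy]
  have e3 : ∀ z : F, quadraticChar F (z ^ 2 - 1) - quadraticChar F z * quadraticChar F (z ^ 2 - 1)
      = (if z = 0 then 1 else 0) + 2 * f (z ^ 2) := by
    intro z
    rcases eq_or_ne z 0 with rfl | hz
    · simp [hf, h1, zero_pow hl]
    · have hz1 : ((z ^ l) ^ 2) ^ 2 = 1 := by
        rw [← pow_mul, ← pow_mul, show l * (2 * 2) = Fintype.card F - 1 by omega]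
        exact FiniteField.pow_card_sub_one_eq_one z hz
      rw [quadraticChar_eq_of_pow hq hz, if_neg hz, pow_right_comm z l 2, hf]
      dsimp only
      rw [pow_right_comm z l 2] at hz1
      rcases sq_eq_one_iff.1 hz1 with h | h
      · simp [h, h11.symm]
      · simp [h, h11]
        ring
  have e4 := Finset.sum_congr (rfl : (Finset.univ : Finset F) = Finset.univ) fun z _ => e3 z
  rw [Finset.sum_sub_distrib, Finset.sum_add_distrib, ← Finset.mul_sum, e2, e1,
    sum_quadraticChar_sq_sub_one hF] at e4
  simp only [Finset.sum_ite_eq', Finset.mem_univ, if_true] at e4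
  rw [jacobsthalSum]
  linear_combination -e4

/-- When `q = 1 + 16 a²`, all cyclotomic numbers `(i, 2)` of order four are equal. -/
theorem four_mul_cyclotomicNumber_neg_one {a : ℤ} (hqa : (Fintype.card F : ℤ) = 1 + 16 * a ^ 2)
    {l : ℕ} (hl : l ≠ 0) (hev : Even l) (hq : Fintype.card F = 4 * l + 1)
    {c : F} (hc : c ^ 4 = 1) : 4 * cyclotomicNumber l c (-1) = l := by
  have hF := ringChar_ne_two_of_card hq
  obtain ⟨p, hchar, ⟨n, hn⟩, hp, hpn⟩ := FiniteField.card' F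
  simp only [PNat.mk_coe] at hpn
  have hqa' : ((p : ℤ)) ^ n = 1 + 16 * a ^ 2 := by rw [← hqa, hpn]; push_cast; rfl
  have hi : (4 * (a : F)) ^ 2 = -1 := by
    have h := congrArg (Int.cast : ℤ → F) hqa
    rw [Int.cast_natCast, FiniteField.cast_card_eq_zero] at h
    push_cast at h
    linear_combination -h
  have h1 : quadraticChar F (-1) = 1 := by
    rw [← hi]
    refine quadraticChar_sq_one' ?_
    rintro h
    simp [h] at hi
  set i : F := 4 * (a : F) with hidef
  have hi0 : i ≠ 0 := by intro h; simp [h] at hi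
  have hii : i⁻¹ = -i := inv_eq_of_mul_eq_one_right (by linear_combination -hi)
  have hC : cyclotomicNumber l (1 : F) (-1) = cyclotomicNumber l (-1 : F) (-1) := by
    rw [cyclotomicNumber_comm hev, cyclotomicNumber_inv hl (by simp), inv_neg_one, one_mul]
  have hE : cyclotomicNumber l i (-1) = cyclotomicNumber l (-i) (-1) := by
    rw [cyclotomicNumber_comm hev, cyclotomicNumber_inv hl (by simp), inv_neg_one, mul_neg_one,
      cyclotomicNumber_comm hev]
  have hsum := sum_cyclotomicNumber_neg_one hl hq hi
  have hP := jacobsthalSum_one_eq_cyclotomicNumber hl hq h1 hi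
  have hp4 : p % 4 = 1 := by
    have := Fact.mk hp
    have h3 : p % 4 ≠ 3 := by
      refine ZMod.mod_four_ne_three_of_sq_eq_neg_one (y := 4 * (a : ZMod p)) ?_
      have h := congrArg (Int.cast : ℤ → ZMod p) hqa'
      push_cast at h
      rw [CharP.cast_eq_zero, zero_pow hn.ne'] at h
      linear_combination -h
    have hodd : p % 2 = 1 := by
      rcases hp.eq_two_or_odd with h | h
      · exfalso
        have : 2 ∣ p ^ n := h ▸ dvd_pow_self _ hn.ne'
        omega
      · exact h
    omega
  obtain ⟨g, hg⟩ := quadraticChar_exists_neg_one hF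
  have hJ := jacobsthalSum_one_sq_add_sq hF h1 hg
  have hPF := intCast_jacobsthalSum_one hl hq
  rw [← hC, ← hE] at hsum hP
  obtain ⟨s, hs⟩ : ∃ s : ℤ, s = 1 + 4 * ((cyclotomicNumber l (1 : F) (-1) : ℤ) -
    cyclotomicNumber l i (-1)) := ⟨_, rfl⟩
  have hPs : jacobsthalSum (1 : F) = -2 * s := by rw [hP, hs]; ring
  rw [hPs, hqa] at hJ
  obtain ⟨t, ht⟩ : ∃ t : ℤ, s ^ 2 + 4 * t ^ 2 = 1 + 16 * a ^ 2 := by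
    have h2 : Even (jacobsthalSum g) := by
      have : Even (jacobsthalSum g ^ 2) := ⟨2 * (1 + 16 * a ^ 2) - 2 * s ^ 2, by linarith⟩
      exact (Int.even_pow.1 this).1
    obtain ⟨r, hr⟩ := h2
    rw [hr] at hJ
    have h4 : Even r := by
      have : Even (r ^ 2) := by
        refine ⟨8 * a ^ 2 - (s - 1) - 8 * ((cyclotomicNumber l (1 : F) (-1) : ℤ) -
          cyclotomicNumber l i (-1)) ^ 2, ?_⟩
        have : s ^ 2 = 1 + 2 * (s - 1) + 16 * ((cyclotomicNumber l (1 : F) (-1) : ℤ) -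
          cyclotomicNumber l i (-1)) ^ 2 := by rw [hs]; ring
        linarith
      exact (Int.even_pow.1 this).1
    obtain ⟨t, rfl⟩ := h4
    exact ⟨t, by linarith⟩
  have hps : ¬ (p : ℤ) ∣ s := by
    intro hd
    have h0 : ((jacobsthalSum (1 : F) : ℤ) : F) = 0 := by
      rw [CharP.intCast_eq_zero_iff F p, hPs]
      exact hd.mul_left _
    rw [hPF, neg_eq_zero, mul_eq_zero, CharP.cast_eq_zero_iff F p] at h0
    rcases h0 with h0 | h0
    · exact pow_ne_zero l (neg_ne_zero.2 one_ne_zero) h0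
    · exact not_dvd_centralBinom_of_prime_pow hp hp4 (hpn.symm.trans hq) h0
  have hs1 := sq_eq_one_of_sq_add_sq_eq hp hn.ne' hqa' (ht.trans hqa'.symm) hps
  have hCE : cyclotomicNumber l (1 : F) (-1) = cyclotomicNumber l i (-1) := by
    -- of the two roots of `s ^ 2 = 1` only `s = 1` is `1` modulo `4`
    rcases sq_eq_one_iff.1 hs1 with h | h <;> omega
  have hc4 : c = 1 ∨ c = -1 ∨ c = i ∨ c = -i := by
    rcases sq_eq_one_iff.1 (show (c ^ 2) ^ 2 = 1 by rw [← pow_mul, hc]) with h | h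
    · rcases sq_eq_one_iff.1 h with h | h <;> simp [h]
    · rw [← hi] at h
      rcases sq_eq_sq_iff_eq_or_eq_neg.1 h with h | h <;> simp [h]
  rcases hc4 with rfl | rfl | rfl | rfl <;> omega

end CyclotomicNumber

/-! ### Cayley digraphs of `F ⋊ H` with connection set `S H` -/

theorem adjacencyMatrix_cayleyDigraph_apply {G : Type*} [Group G] (E : Set G) (x y : G) :
    (cayleyDigraph E).adjacencyMatrix x y = E.indicator (1 : G → ℤ) (x⁻¹ * y) := by
  classical
  rw [Set.indicator_apply]
  simp only [Digraph.adjacencyMatrix, cayleyDigraph, Matrix.of_apply, Pi.one_apply]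
  congr

namespace FieldSemidirect

variable {F : Type*} [Field F] {l : ℕ} {u : Fˣ} {hu : u ^ l = 1}

theorem mem_setMulH {S : Set F} {g : FieldSemidirect l u hu} :
    g ∈ setMulH l u hu S ↔ Multiplicative.toAdd g.left ∈ S := by
  constructor
  · rintro ⟨s, hs, h, rfl⟩
    simpa using hs
  · intro h
    exact ⟨_, h, g.right, (SemidirectProduct.inl_left_mul_inr_right g).symm⟩

theorem toAdd_left_inv_mul (x y : FieldSemidirect l u hu) :
    Multiplicative.toAdd (x⁻¹ * y).left = ((cyclicHom l u hu x.right⁻¹ : Fˣ) : F) *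
      (Multiplicative.toAdd y.left - Multiplicative.toAdd x.left) := by
  change ((cyclicHom l u hu x.right⁻¹ : Fˣ) : F) * (-Multiplicative.toAdd x.left) +
    ((cyclicHom l u hu x.right⁻¹ : Fˣ) : F) * Multiplicative.toAdd y.left = _
  ring

theorem sum_eq_sum_sum {M : Type*} [AddCommMonoid M] [Fintype F] [NeZero l]
    [Fintype (FieldSemidirect l u hu)] (f : FieldSemidirect l u hu → M) :
    ∑ g, f g = ∑ s : F, ∑ h : Multiplicative (ZMod l), f ⟨Multiplicative.ofAdd s, h⟩ := by
  rw [← Equiv.sum_comp SemidirectProduct.equivProd.symm f, Fintype.sum_prod_type]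
  exact (Equiv.sum_comp Multiplicative.ofAdd _).symm

open Classical in
/-- If `S` meets every orbit of `H` on `F \ {0}` in `n` points (counted by elements of `H`), then
`E² = n |S| G - n E` in the group ring for `E = S H`; this is the coefficient of `g`. -/
theorem sum_indicator_mul_indicator [Fintype F] [NeZero l]
    [Fintype (FieldSemidirect l u hu)] {S : Set F} {k n : ℕ}
    (h0 : (0 : F) ∉ S) (hS : (Finset.univ.filter (· ∈ S)).card = k)
    (horb : ∀ v : F, v ≠ 0 → (Finset.univ.filter
      fun h : Multiplicative (ZMod l) => (cyclicHom l u hu h : F) * v ∈ S).card = n)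
    (g : FieldSemidirect l u hu) :
    ∑ w : FieldSemidirect l u hu, (setMulH l u hu S).indicator (1 : FieldSemidirect l u hu → ℤ) w *
      (setMulH l u hu S).indicator 1 (w⁻¹ * g) =
    n * k - n * (setMulH l u hu S).indicator 1 g := by
  have hinner : ∀ v : F, ∑ h : Multiplicative (ZMod l),
      (if ((cyclicHom l u hu h⁻¹ : Fˣ) : F) * v ∈ S then (1 : ℤ) else 0) =
      n - n * if v = 0 then 1 else 0 := by
    intro v
    refine (Equiv.sum_comp (Equiv.inv (Multiplicative (ZMod l)))
      (fun h => if ((cyclicHom l u hu h : Fˣ) : F) * v ∈ S then (1 : ℤ) else 0)).trans ?_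
    split_ifs with hv
    · simp [hv, h0]
    · rw [Finset.sum_boole, horb v hv]
      simp
  rw [sum_eq_sum_sum]
  simp_rw [Set.indicator_apply, mem_setMulH, Pi.one_apply, toAdd_left_inv_mul, ← Finset.mul_sum,
    toAdd_ofAdd, hinner, mul_sub,
    Finset.sum_sub_distrib, ← Finset.sum_mul, Finset.sum_boole, hS, mul_left_comm _ (n : ℤ),
    ← Finset.mul_sum, sub_eq_zero]
  simp [mul_comm]

theorem isDirectedStronglyRegular_setMulH [Fintype F] [NeZero l] {S : Set F} {k n : ℕ}
    (hk : k ≠ 0) (h0 : (0 : F) ∉ S) (hS : S.ncard = k)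
    (horb : ∀ v : F, v ≠ 0 →
      {h : Multiplicative (ZMod l) | (cyclicHom l u hu h : F) * v ∈ S}.ncard = n) :
    IsDirectedStronglyRegular (cayleyDigraph (setMulH l u hu S)) (Fintype.card F * l) (k * l)
      (n * k) (n * k - n) (n * k) := by
  classical
  let _ : Fintype (FieldSemidirect l u hu) :=
    Fintype.ofEquiv _ (SemidirectProduct.equivProd).symm
  have hS' : (Finset.univ.filter (· ∈ S)).card = k := by
    rw [← hS, ← Set.ncard_coe_finset]
    simp
  have horb' : ∀ v : F, v ≠ 0 → (Finset.univ.filter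
      fun h : Multiplicative (ZMod l) => (cyclicHom l u hu h : F) * v ∈ S).card = n := by
    intro v hv
    rw [← horb v hv, ← Set.ncard_coe_finset]
    simp
  have hcard : ∑ w : FieldSemidirect l u hu,
      (setMulH l u hu S).indicator (1 : FieldSemidirect l u hu → ℤ) w = k * l := by
    rw [sum_eq_sum_sum]
    simp_rw [Set.indicator_apply, mem_setMulH, Pi.one_apply, toAdd_ofAdd, Finset.sum_const,
      ← Finset.smul_sum, Finset.sum_boole, hS']
    simp [mul_comm]
  refine ⟨inferInstance, ?_, ?_, ?_, ?_, ?_⟩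
  · rw [Fintype.card_congr (SemidirectProduct.equivProd), Fintype.card_prod]
    simp [ZMod.card]
  · intro x
    change ¬ x⁻¹ * x ∈ setMulH l u hu S
    rw [inv_mul_cancel, mem_setMulH]
    exact h0
  · ext x y
    have hle : n ≤ n * k := Nat.le_mul_of_pos_right n (Nat.pos_of_ne_zero hk)
    have h := sum_indicator_mul_indicator h0 hS' horb' (x⁻¹ * y)
    rw [← Equiv.sum_comp (Equiv.mulLeft x⁻¹)] at h
    simp only [Equiv.coe_mulLeft, mul_inv_rev, inv_inv, mul_assoc, mul_inv_cancel_left] at h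
    simp only [Matrix.mul_apply, adjacencyMatrix_cayleyDigraph_apply, Matrix.of_apply,
      Matrix.add_apply, Matrix.smul_apply, Matrix.sub_apply, allOnesMatrix, smul_eq_mul,
      Nat.cast_sub hle, Nat.cast_mul]
    rw [h]
    ring
  · ext x y
    simp only [Matrix.mul_apply, adjacencyMatrix_cayleyDigraph_apply, Matrix.of_apply,
      Matrix.smul_apply, allOnesMatrix, smul_eq_mul, Nat.cast_mul, mul_one]
    rw [← hcard]
    exact Equiv.sum_comp (Equiv.mulLeft x⁻¹) ((setMulH l u hu S).indicator 1)
  · ext x y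
    simp only [Matrix.mul_apply, adjacencyMatrix_cayleyDigraph_apply, Matrix.of_apply,
      Matrix.smul_apply, allOnesMatrix, smul_eq_mul, Nat.cast_mul, mul_one, one_mul]
    rw [← hcard]
    exact Equiv.sum_comp ((Equiv.inv _).trans (Equiv.mulRight y))
      ((setMulH l u hu S).indicator 1)

theorem closure_setMulH_eq_top {S : Set F} (hS : S.Nonempty)
    (horb : ∀ v : F, v ≠ 0 → ∃ h : Multiplicative (ZMod l), (cyclicHom l u hu h : F) * v ∈ S) :
    Subgroup.closure (setMulH l u hu S) = ⊤ := by
  have hinr : ∀ h, (SemidirectProduct.inr h : FieldSemidirect l u hu) ∈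
      Subgroup.closure (setMulH l u hu S) := by
    intro h
    obtain ⟨s, hs⟩ := hS
    have h1 : (SemidirectProduct.inl (Multiplicative.ofAdd s) : FieldSemidirect l u hu) ∈
        Subgroup.closure (setMulH l u hu S) :=
      Subgroup.subset_closure ⟨s, hs, 1, by simp⟩
    have h2 := Subgroup.subset_closure (G := FieldSemidirect l u hu) (k := setMulH l u hu S)
      ⟨s, hs, h, rfl⟩
    exact (Subgroup.mul_mem_cancel_left _ h1).1 h2
  refine (Subgroup.eq_top_iff' _).2 fun g => ?_
  rw [← SemidirectProduct.inl_left_mul_inr_right g]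
  refine mul_mem ?_ (hinr _)
  by_cases hv : Multiplicative.toAdd g.left = 0
  · rw [show g.left = 1 from hv, map_one]
    exact one_mem _
  · obtain ⟨h, hh⟩ := horb _ hv
    have hE : SemidirectProduct.inr h * SemidirectProduct.inl g.left ∈ setMulH l u hu S := by
      rw [mem_setMulH]
      simp only [SemidirectProduct.mul_left, SemidirectProduct.left_inr, one_mul]
      exact hh
    exact (Subgroup.mul_mem_cancel_left _ (hinr h)).1 (Subgroup.subset_closure hE)

end FieldSemidirect

/-! ### Quartic classes as fibres of `x ↦ x ^ l` -/

theorem cyclicHom_eq_pow {M : Type*} [Group M] (l : ℕ) [NeZero l] (u : M) (hu : u ^ l = 1)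
    (h : Multiplicative (ZMod l)) :
    cyclicHom l u hu h = u ^ (Multiplicative.toAdd h).val := by
  have : h = Multiplicative.ofAdd (1 : ZMod l) ^ (Multiplicative.toAdd h).val := by
    rw [← ofAdd_nsmul, nsmul_one, ZMod.natCast_zmod_val, ofAdd_toAdd]
  nth_rw 1 [this]
  rw [map_pow, cyclicHom_generator]

theorem cyclicHom_injective {M : Type*} [Group M] {l : ℕ} [NeZero l] {u : M} (hu : u ^ l = 1)
    (hord : orderOf u = l) : Function.Injective (cyclicHom l u hu) := by
  intro g h hgh
  rw [cyclicHom_eq_pow, cyclicHom_eq_pow] at hgh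
  have := pow_injOn_Iio_orderOf (by simpa [hord] using ZMod.val_lt _)
    (by simpa [hord] using ZMod.val_lt _) hgh
  exact Multiplicative.toAdd.injective (ZMod.val_injective l this)

section Fibres

variable {F : Type*} [Field F] [Fintype F] {γ : Fˣ} {l : ℕ}

theorem orderOf_eq_of_generator (hγ : ∀ x : Fˣ, x ∈ Subgroup.zpowers γ)
    (hq : Fintype.card F = 4 * l + 1) : orderOf γ = 4 * l := by
  classical
  rw [orderOf_eq_card_of_forall_mem_zpowers hγ, Nat.card_eq_fintype_card, Fintype.card_units, hq,
    Nat.add_sub_cancel]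

theorem pow_two_mul_generator (hγ : ∀ x : Fˣ, x ∈ Subgroup.zpowers γ)
    (hl : l ≠ 0) (hq : Fintype.card F = 4 * l + 1) : (γ : F) ^ (2 * l) = -1 := by
  have hord := orderOf_eq_of_generator hγ hq
  have h1 : ((γ : F) ^ (2 * l)) ^ 2 = 1 := by
    rw [← pow_mul, show 2 * l * 2 = 4 * l by ring, ← hord]
    rw [← Units.val_pow_eq_pow_val, pow_orderOf_eq_one, Units.val_one]
  refine (sq_eq_one_iff.1 h1).resolve_left fun h => ?_
  have h2 : γ ^ (2 * l) = 1 := Units.ext (by simpa using h)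
  have := Nat.le_of_dvd (by omega) (orderOf_dvd_of_pow_eq_one h2)
  omega

theorem mem_zpowers_pow_four_iff (hγ : ∀ x : Fˣ, x ∈ Subgroup.zpowers γ)
    (hl : l ≠ 0) (hq : Fintype.card F = 4 * l + 1) {x : Fˣ} :
    x ∈ Subgroup.zpowers (γ ^ 4) ↔ x ^ l = 1 := by
  have hord := orderOf_eq_of_generator hγ hq
  constructor
  · rintro ⟨k, rfl⟩
    dsimp only
    rw [← zpow_natCast, ← zpow_mul, mul_comm, zpow_mul, zpow_natCast, ← pow_mul, ← hord,
      pow_orderOf_eq_one, one_zpow]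
  · intro h
    obtain ⟨k, rfl⟩ := hγ x
    dsimp only at h
    rw [← zpow_natCast, ← zpow_mul, ← orderOf_dvd_iff_zpow_eq_one, hord] at h
    push_cast at h
    obtain ⟨j, rfl⟩ := Int.dvd_of_mul_dvd_mul_right (by exact_mod_cast hl) h
    exact ⟨j, by dsimp only; rw [zpow_mul]; norm_cast⟩

theorem mem_cyclotomicClass_two_iff (hγ : ∀ x : Fˣ, x ∈ Subgroup.zpowers γ)
    (hl : l ≠ 0) (hq : Fintype.card F = 4 * l + 1) {x : F} :
    x ∈ cyclotomicClass γ 4 2 ↔ x ^ l = -1 := by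
  have hγl := pow_two_mul_generator hγ hl hq
  constructor
  · rintro ⟨y, hy, rfl⟩
    have hy' := congrArg Units.val ((mem_zpowers_pow_four_iff hγ hl hq).1 hy)
    push_cast at hy' ⊢
    rw [mul_pow, hy', ← pow_mul, hγl, mul_one]
  · intro h
    have hx : x ≠ 0 := by rintro rfl; simp [zero_pow hl] at h
    refine ⟨(γ ^ 2)⁻¹ * Units.mk0 x hx, (mem_zpowers_pow_four_iff hγ hl hq).2 ?_, by simp⟩
    ext
    push_cast
    rw [mul_pow, inv_pow, ← pow_mul, hγl, Units.val_mk0, h]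
    simp

/-- The elements of `H` that carry `v` into `-1 + D₂` correspond to the points of the class of `v`
lying in `-1 + D₂`. -/
theorem ncard_cyclicHom_mul_mem [DecidableEq F] (hγ : ∀ x : Fˣ, x ∈ Subgroup.zpowers γ)
    [NeZero l] (hq : Fintype.card F = 4 * l + 1) (hu : (γ ^ 4) ^ l = 1) {v : F} (hv : v ≠ 0) :
    {h : Multiplicative (ZMod l) |
      (((cyclicHom l (γ ^ 4) hu h : Fˣ) : F) * v + 1) ^ l = -1}.ncard =
      cyclotomicNumber l (v ^ l) (-1) := by
  have hl : l ≠ 0 := NeZero.ne l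
  have hord : orderOf (γ ^ 4) = l := by
    rw [orderOf_pow, orderOf_eq_of_generator hγ hq, Nat.gcd_eq_right (dvd_mul_right 4 l)]
    exact Nat.mul_div_cancel_left l (by norm_num)
  have hinj : Function.Injective fun h : Multiplicative (ZMod l) =>
      ((cyclicHom l (γ ^ 4) hu h : Fˣ) : F) * v :=
    fun g h hgh => cyclicHom_injective hu hord (Units.ext (mul_right_cancel₀ hv hgh))
  rw [cyclotomicNumber, ← Set.ncard_coe_finset, ← Set.ncard_image_of_injective _ hinj]
  congr 1
  ext x
  simp only [Set.mem_image, Set.mem_ofPred_eq, Finset.coe_filter, Finset.mem_univ, true_and]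
  constructor
  · rintro ⟨h, hh, rfl⟩
    refine ⟨?_, hh⟩
    rw [cyclicHom_eq_pow, mul_pow, ← Units.val_pow_eq_pow_val, ← pow_mul, mul_comm _ l, pow_mul,
      hu, one_pow, Units.val_one, one_mul]
  · rintro ⟨hx, hx1⟩
    have hx0 : x ≠ 0 := by
      rintro rfl
      rw [zero_pow hl] at hx
      exact pow_ne_zero l hv hx.symm
    have hmem : Units.mk0 (x / v) (div_ne_zero hx0 hv) ∈ Subgroup.zpowers (γ ^ 4) := by
      rw [mem_zpowers_pow_four_iff hγ hl hq]
      ext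
      rw [Units.val_pow_eq_pow_val, Units.val_mk0, div_pow, hx, div_self (pow_ne_zero l hv),
        Units.val_one]
    obtain ⟨k, hk⟩ := hmem
    refine ⟨Multiplicative.ofAdd (1 : ZMod l) ^ k, ?_⟩
    have he : ((cyclicHom l (γ ^ 4) hu (Multiplicative.ofAdd (1 : ZMod l) ^ k) : Fˣ) : F) * v
        = x := by
      rw [map_zpow, cyclicHom_generator]
      rw [show (γ ^ 4) ^ k = _ from hk, Units.val_mk0, div_mul_cancel₀ x hv]
    exact ⟨by rw [he]; exact hx1, he⟩

end Fibres

/-- Since `q = 1 + 16 a²`, all the quotients below are exact. -/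
theorem mainTheorem5 {F : Type*} [Field F] [Fintype F] (q : ℕ) (hF : Fintype.card F = q)
    (a : ℤ) (hq : (q : ℤ) = 1 + 16 * a ^ 2)
    (γ : Fˣ) (hγ : ∀ x : Fˣ, x ∈ Subgroup.zpowers γ)
    (l : ℕ) (hl : l = (q - 1) / 4)
    (S : Set F) (hS : S = {y | ∃ x ∈ cyclotomicClass γ 4 2, y = -1 + x})
    (E : Set (FieldSemidirect l (γ ^ 4) (pow_four_pow_eq_one hF hq hl γ)))
    (hE : E = FieldSemidirect.setMulH l (γ ^ 4) (pow_four_pow_eq_one hF hq hl γ) S) :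
    Subgroup.closure E = ⊤ ∧
    IsDirectedStronglyRegular (cayleyDigraph E)
      (q * ((q - 1) / 4))
      (((q - 1) / 4) ^ 2)
      (((q - 1) / 8) ^ 2)
      (((q - 1) / 8) ^ 2 - (q - 1) / 16)
      (((q - 1) / 8) ^ 2) := by
  classical
  obtain ⟨n, hn⟩ : ∃ n : ℕ, (n : ℤ) = a ^ 2 := ⟨(a ^ 2).toNat, Int.toNat_of_nonneg (sq_nonneg a)⟩
  have hqa := hq
  rw [← hn] at hq
  have hln : l = 4 * n := by omega
  have hcard : Fintype.card F = 4 * l + 1 := by omega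
  have hl0 : l ≠ 0 := by
    have := Fintype.one_lt_card (α := F)
    omega
  have : NeZero l := ⟨hl0⟩
  have hev : Even l := ⟨2 * n, by omega⟩
  have h11 : (1 : F) ≠ -1 :=
    (Ring.neg_one_ne_one_of_char_ne_two (ringChar_ne_two_of_card hcard)).symm
  have hmemS : ∀ y, y ∈ S ↔ (y + 1) ^ l = -1 := by
    intro y
    rw [hS, ← mem_cyclotomicClass_two_iff hγ hl0 hcard]
    constructor
    · rintro ⟨x, hx, rfl⟩
      simpa using hx
    · intro h
      exact ⟨y + 1, h, by ring⟩
  have h0S : (0 : F) ∉ S := by simp [hmemS, h11]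
  have horb : ∀ v : F, v ≠ 0 → {h : Multiplicative (ZMod l) |
      (cyclicHom l (γ ^ 4) (pow_four_pow_eq_one hF hqa hl γ) h : F) * v ∈ S}.ncard = n := by
    intro v hv
    have hv4 : (v ^ l) ^ 4 = 1 := by
      rw [← pow_mul, show l * 4 = Fintype.card F - 1 by omega]
      exact FiniteField.pow_card_sub_one_eq_one v hv
    have h := four_mul_cyclotomicNumber_neg_one (by rw [hF]; exact hqa) hl0 hev hcard hv4
    simp_rw [hmemS]
    rw [ncard_cyclicHom_mul_mem hγ hcard _ hv]
    omega
  have hScard : S.ncard = l := by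
    have hγ2 : ((γ : F) ^ l) ^ 2 = -1 := by
      rw [← pow_mul, mul_comm, pow_two_mul_generator hγ hl0 hcard]
    rw [← card_filter_pow_eq_neg_one hl0 hcard hγ2, ← Set.ncard_coe_finset,
      ← Set.ncard_image_of_injective S (add_left_injective (1 : F))]
    congr 1
    ext x
    simp only [Set.mem_image, hmemS, Finset.coe_filter, Finset.mem_univ, true_and,
      Set.mem_ofPred_eq]
    exact ⟨by rintro ⟨y, hy, rfl⟩; exact hy, fun hx => ⟨x - 1, by simpa using hx, by simp⟩⟩
  subst hE
  constructor
  · refine FieldSemidirect.closure_setMulH_eq_top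
      (Set.nonempty_of_ncard_ne_zero (by rw [hScard]; exact hl0)) fun v hv => ?_
    have hne := horb v hv
    exact Set.nonempty_of_ncard_ne_zero (hne.trans_ne (by omega))
  · have h := FieldSemidirect.isDirectedStronglyRegular_setMulH hl0 h0S hScard horb
    have h4 : (q - 1) / 4 = l := hl.symm
    have h8 : (q - 1) / 8 = 2 * n := by omega
    have h16 : (q - 1) / 16 = n := by omega
    have hnl : (2 * n) ^ 2 = n * l := by rw [hln]; ring
    rw [h4, h8, h16, hnl]
    rw [hF, ← sq l] at h
    exact h
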